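/- A base station has $M\ge 1$ antennas and there are $K$ user equipments (UEs). The channel of UE $i$ is $\mathbf h_i\sim\mathcal{CN}(\mathbf 0,\beta_i\mathbf I_M)$ with $\beta_i>0$, and $S\subseteq\{1,\dots,K\}$ is the (fixed) set of UEs that transmit the same uplink pilot with power $\rho>0$. The base station receives $$\mathbf y=\sum_{i\in S}\sqrt{\rho}\,\mathbf h_i+\mathbf n,\qquad \mathbf n\sim\mathcal{CN}(\mathbf 0,\sigma^2\mathbf I_M),$$ forms the least-squares estimate $\hat{\mathbf h}_{\mathrm{LS}}=\mathbf y/\sqrt{\rho}$ and the precoding vector $\mathbf w=\sqrt q\,\hat{\mathbf h}_{\mathrm{LS}}/\|\hat{\mathbf h}_{\mathrm{LS}}\|$ with downlink power $q\ge 0$ (with the convention $\mathbf w=\mathbf 0$ if $\hat{\mathbf h}_{\mathrm{LS}}=\mathbf 0$), and UE $k\in S$ receives the downlink pilot signal $$z_k=\mathbf h_k^{\mathrm H}\mathbf w+\eta_k,\qquad \eta_k\sim\mathcal{CN}(0,\sigma^2).$$ For each $k\in S$ the variables $\mathbf h_1,\dots,\mathbf h_K,\mathbf n,\eta_k$ are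 mutually independent. Let $\alpha_S=\sum_{i\in S}\beta_i$. Then for every $k\in S$ the received signal can be expressed as $z_k=g_k+\nu_k$, where $$g_k=\sqrt{\frac12\,\frac{\rho q\beta_k^2}{\rho\alpha_S+\sigma^2}}\;x,\quad x\sim\chi_{2M},\qquad \nu_k\sim\mathcal{CN}\!\left(0,\ \sigma^2+q\beta_k-\frac{\rho q\beta_k^2}{\rho\alpha_S+\sigma^2}\right),$$ the variance of $\nu_k$ being nonnegative, and $g_k$ and $\nu_k$ are independent. Here $\chi_n$ is the chi distribution with $n$ degrees of freedom (the law of the Euclidean norm of $n$ independent standard real Gaussians), and $\mathcal{CN}(0,c)$ is the law of a complex variable whose real and imaginary parts are independent real Gaussians with mean $0$ and variance $c/2$; $\mathcal{CN}(\mathbf 0,c\,\mathbf I_M)$ is the law of $M$ independent $\mathcal{CN}(0,c)$ coordinates. -/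

import Mathlib

open MeasureTheory ProbabilityTheory

noncomputable section

/-- The law `CN(0, c)` of a circularly symmetric complex Gaussian variable of variance `c ≥ 0`:
the real and imaginary parts are independent real Gaussians, each of variance `c / 2`. -/
def complexGaussian (c : ℝ) : Measure ℂ :=
  ((gaussianReal 0 (c / 2).toNNReal).prod (gaussianReal 0 (c / 2).toNNReal)).map
    (fun p : ℝ × ℝ => (p.1 : ℂ) + (p.2 : ℂ) * Complex.I)

/-- The law `CN(0, c I_M)` on `ℂ^M`: independent coordinates, each with law `CN(0, c)`. -/
def complexGaussianVec (M : ℕ) (c : ℝ) : Measure (EuclideanSpace ℂ (Fin M)) :=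
  (Measure.pi (fun _ : Fin M => complexGaussian c)).map (WithLp.toLp 2)

/-- The chi distribution with `n` degrees of freedom: the law of the square root of the sum of
the squares of `n` independent standard real Gaussian variables. -/
def chiDist (n : ℕ) : Measure ℝ :=
  (Measure.pi (fun _ : Fin n => gaussianReal 0 1)).map (fun v => Real.sqrt (∑ i, v i ^ 2))

/-- The signal `y = ∑_{i ∈ S} √ρ h_i + n` received by the base station. -/
def uplinkSignal {K M : ℕ} (S : Finset (Fin K)) (ρ : ℝ)
    (h : Fin K → EuclideanSpace ℂ (Fin M)) (n : EuclideanSpace ℂ (Fin M)) :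
    EuclideanSpace ℂ (Fin M) :=
  ∑ i ∈ S, ((Real.sqrt ρ : ℝ) : ℂ) • h i + n

/-- The least-squares estimate `y / √ρ` of `∑_{i ∈ S} h_i`. -/
def lsEstimate {M : ℕ} (ρ : ℝ) (y : EuclideanSpace ℂ (Fin M)) : EuclideanSpace ℂ (Fin M) :=
  ((1 / Real.sqrt ρ : ℝ) : ℂ) • y

/-- The precoding vector `√q u / ‖u‖` for the channel estimate `u` (Euclidean norm). -/
def precoder {M : ℕ} (q : ℝ) (u : EuclideanSpace ℂ (Fin M)) : EuclideanSpace ℂ (Fin M) :=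
  ((Real.sqrt q / ‖u‖ : ℝ) : ℂ) • u

/-- The downlink pilot signal `z_k = h_kᴴ w + η_k` received by user `k`, where `w` is the precoding
vector formed from the least-squares estimate; `inner ℂ a b = aᴴ b`. -/
def downlinkSignal {K M : ℕ} (S : Finset (Fin K)) (ρ q : ℝ)
    (h : Fin K → EuclideanSpace ℂ (Fin M)) (n : EuclideanSpace ℂ (Fin M)) (η : Fin K → ℂ)
    (k : Fin K) : ℂ :=
  inner ℂ (h k) (precoder q (lsEstimate ρ (uplinkSignal S ρ h n))) + η k

/-- The sum `α_S = ∑_{i ∈ S} β_i` of the channel gains of the users in `S`. -/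
def sumGain {K : ℕ} (S : Finset (Fin K)) (β : Fin K → ℝ) : ℝ := ∑ i ∈ S, β i

end

/-!
The least-squares estimate is `u = h_k + v`, where `v` collects the interference and the noise and
is an isotropic Gaussian vector independent of `h_k`. With `γ = α_S + σ² / ρ` the variance of
`u`, the residual `h_k - (β_k / γ) u` is uncorrelated with `u`, hence independent of it by joint
Gaussianity. Given `u`, the precoding vector `w` has norm `√q`, so by isotropy the law of the
projection of the residual on `w` does not depend on `u`: after adding `η_k` it is a complex
Gaussian `ν_k` independent of `u`. The remaining part of `z_k` is
`(β_k / γ) uᴴ w = (β_k / γ) √q ‖u‖`, a scaled chi variable.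
-/

section Independence

variable {Ω : Type*} [MeasurableSpace Ω] {P : Measure Ω}
  {α γ δ : Type*} [MeasurableSpace α] [MeasurableSpace γ] [MeasurableSpace δ]

lemma indepFun_prodMk_right_of_prodMk_left [IsFiniteMeasure P] {X : Ω → α} {Y : Ω → γ} {Z : Ω → δ}
    (hX : AEMeasurable X P) (hY : AEMeasurable Y P) (hZ : AEMeasurable Z P)
    (hXY : IndepFun X Y P) (hXYZ : IndepFun (fun ω => (X ω, Y ω)) Z P) :
    IndepFun X (fun ω => (Y ω, Z ω)) P := by
  have hYZ : IndepFun Y Z P := hXYZ.comp measurable_snd measurable_id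
  have hX_law : HasLaw X (P.map X) P := ⟨hX, rfl⟩
  have hY_law : HasLaw Y (P.map Y) P := ⟨hY, rfl⟩
  have hZ_law : HasLaw Z (P.map Z) P := ⟨hZ, rfl⟩
  have hassoc : MeasurePreserving MeasurableEquiv.prodAssoc
      (((P.map X).prod (P.map Y)).prod (P.map Z)) ((P.map X).prod ((P.map Y).prod (P.map Z))) :=
    ⟨MeasurableEquiv.prodAssoc.measurable, Measure.prodAssoc_prod⟩
  rw [indepFun_iff_hasLaw_prodMk_prod hX_law (hYZ.hasLaw_prod hY_law hZ_law)]
  exact hassoc.fun_comp_hasLaw (hXYZ.hasLaw_prod (hXY.hasLaw_prod hX_law hY_law) hZ_law)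

lemma hasLaw_and_indepFun_of_ae_map_eq [IsProbabilityMeasure P] {X : Ω → α} {Z : Ω → γ}
    {μ : Measure α} {ξ : Measure γ} {κ : Measure δ} {f : α → γ → δ}
    (hX : HasLaw X μ P) (hZ : HasLaw Z ξ P) (hXZ : IndepFun X Z P)
    (hf : Measurable (Function.uncurry f)) (hκ : ∀ᵐ x ∂μ, ξ.map (f x) = κ) :
    HasLaw (fun ω => f (X ω) (Z ω)) κ P ∧ IndepFun X (fun ω => f (X ω) (Z ω)) P := by
  have : IsProbabilityMeasure μ := hX.isProbabilityMeasure_iff.1 inferInstance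
  have : IsProbabilityMeasure ξ := hZ.isProbabilityMeasure_iff.1 inferInstance
  have : SFinite κ := by
    obtain ⟨x, rfl⟩ := hκ.exists
    infer_instance
  have hpair : HasLaw (fun ω => (X ω, f (X ω) (Z ω))) (μ.prod κ) P :=
    ((MeasurePreserving.id μ).skew_product hf hκ).fun_comp_hasLaw (hXZ.hasLaw_prod hX hZ)
  have hf_law : HasLaw (fun ω => f (X ω) (Z ω)) κ P :=
    measurePreserving_snd.fun_comp_hasLaw hpair
  exact ⟨hf_law, (indepFun_iff_hasLaw_prodMk_prod hX hf_law).2 hpair⟩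

end Independence

lemma sub_div_smul_add {𝕜 V : Type*} [Field 𝕜] [AddCommGroup V] [Module 𝕜 V] {a b : 𝕜}
    (hab : a + b ≠ 0) (x y : V) :
    x - (a / (a + b)) • (x + y) = (b / (a + b)) • x + (-(a / (a + b))) • y := by
  have hb : b / (a + b) = 1 - a / (a + b) := by
    rw [eq_sub_iff_add_eq', ← add_div, div_self hab]
  rw [hb]
  module

section IsotropicGaussian

variable {Ω : Type*} [MeasurableSpace Ω] {P : Measure Ω}
  (E : Type*) [NormedAddCommGroup E] [InnerProductSpace ℝ E] [FiniteDimensional ℝ E]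
  [MeasurableSpace E]

/-- The centred Gaussian law on `E` with variance `v` in each unit direction. For `v < 0` the
junk value `√v = 0` makes it the Dirac mass at `0`. -/
noncomputable def isotropicGaussian (v : ℝ) : Measure E :=
  (stdGaussian E).map (fun x => Real.sqrt v • x)

lemma isotropicGaussian_one : isotropicGaussian E 1 = stdGaussian E := by
  simp [isotropicGaussian]

variable [BorelSpace E] {a b v : ℝ}

instance isGaussian_isotropicGaussian : IsGaussian (isotropicGaussian E v) :=
  isGaussian_map (Real.sqrt v • ContinuousLinearMap.id ℝ E)

lemma hasLaw_norm_stdGaussian :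
    HasLaw (fun x => ‖x‖) (chiDist (Module.finrank ℝ E)) (stdGaussian E) where
  map_eq := by
    rw [stdGaussian, Measure.map_map (by fun_prop) (by fun_prop), chiDist]
    congr 1 with x
    have hrepr := (stdOrthonormalBasis ℝ E).sum_repr_symm (WithLp.toLp 2 x)
    simp only [Function.comp_apply] at hrepr ⊢
    rw [hrepr, LinearIsometryEquiv.norm_map, EuclideanSpace.norm_eq]
    simp only [Real.norm_eq_abs, sq_abs]

variable {E}

lemma charFun_isotropicGaussian (hv : 0 ≤ v) (t : E) :
    charFun (isotropicGaussian E v) t = Complex.exp ((-(v * ‖t‖ ^ 2 / 2) : ℝ) : ℂ) := by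
  rw [isotropicGaussian, charFun_map_smul, charFun_stdGaussian, ← Complex.ofReal_pow, norm_smul,
    mul_pow, Real.norm_eq_abs, sq_abs, Real.sq_sqrt hv]
  push_cast
  rw [neg_div]

lemma eq_isotropicGaussian_of_charFun (hv : 0 ≤ v) {μ : Measure E} [IsFiniteMeasure μ]
    (hμ : ∀ t, charFun μ t = Complex.exp ((-(v * ‖t‖ ^ 2 / 2) : ℝ) : ℂ)) :
    μ = isotropicGaussian E v :=
  Measure.ext_of_charFun (funext fun t => (hμ t).trans (charFun_isotropicGaussian hv t).symm)

lemma covariance_inner_isotropicGaussian {X : Ω → E} (hv : 0 ≤ v)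
    (hX : HasLaw X (isotropicGaussian E v) P) (x y : E) :
    cov[fun ω => inner ℝ x (X ω), fun ω => inner ℝ y (X ω); P] = v * inner ℝ x y := by
  have hcov : cov[fun z => inner ℝ x z, fun z => inner ℝ y z; stdGaussian E] = inner ℝ x y := by
    rw [← covarianceBilin_apply_eq_cov IsGaussian.memLp_two_id, covarianceBilin_stdGaussian,
      innerSL_apply_apply]
  rw [hX.covariance_fun_comp (f := fun z => inner ℝ x z) (g := fun z => inner ℝ y z)
      (by fun_prop) (by fun_prop), isotropicGaussian,
    covariance_map_fun (by fun_prop) (by fun_prop) (by fun_prop)]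
  simp only [inner_smul_right]
  rw [covariance_const_mul_left, covariance_const_mul_right, hcov, ← mul_assoc,
    Real.mul_self_sqrt hv]

lemma nullSingletonClass_isotropicGaussian [Nontrivial E] (hv : 0 < v) :
    NullSingletonClass (isotropicGaussian E v) := by
  refine IsGaussian.nullSingletonClass fun x₀ hdirac => ?_
  obtain ⟨x, hx⟩ := exists_ne (0 : E)
  have hcov := covariance_inner_isotropicGaussian hv.le HasLaw.id x x
  simp [hdirac, covariance, hv.ne', hx] at hcov

lemma hasLaw_smul_isotropicGaussian {X : Ω → E} (hv : 0 ≤ v)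
    (hX : HasLaw X (isotropicGaussian E v) P) (r : ℝ) :
    HasLaw (fun ω => r • X ω) (isotropicGaussian E (r ^ 2 * v)) P where
  map_eq := by
    have := hX.hasGaussianLaw.isProbabilityMeasure
    refine eq_isotropicGaussian_of_charFun (by positivity) fun t => ?_
    rw [charFun_map_smul_comp hX.aemeasurable, hX.map_eq, charFun_isotropicGaussian hv, norm_smul,
      mul_pow, Real.norm_eq_abs, sq_abs]
    congr 2
    ring

lemma hasLaw_add_isotropicGaussian {X Y : Ω → E} (ha : 0 ≤ a) (hb : 0 ≤ b)
    (hX : HasLaw X (isotropicGaussian E a) P) (hY : HasLaw Y (isotropicGaussian E b) P)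
    (hXY : IndepFun X Y P) :
    HasLaw (fun ω => X ω + Y ω) (isotropicGaussian E (a + b)) P where
  map_eq := by
    have := hX.hasGaussianLaw.isProbabilityMeasure
    refine eq_isotropicGaussian_of_charFun (by positivity) fun t => ?_
    rw [hXY.charFun_map_fun_add_eq_mul hX.aemeasurable hY.aemeasurable, Pi.mul_apply, hX.map_eq,
      hY.map_eq, charFun_isotropicGaussian ha, charFun_isotropicGaussian hb, ← Complex.exp_add,
      ← Complex.ofReal_add]
    congr 2
    ring

lemma hasLaw_sum_isotropicGaussian {ι : Type*} {v : ι → ℝ} {s : Finset ι} {X : ι → Ω → E}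
    (hv : ∀ i ∈ s, 0 ≤ v i)
    (hX : ∀ i ∈ s, HasLaw (X i) (isotropicGaussian E (v i)) P) (h_indep : iIndepFun X P) :
    HasLaw (fun ω => ∑ i ∈ s, X i ω) (isotropicGaussian E (∑ i ∈ s, v i)) P where
  map_eq := by
    have := h_indep.isProbabilityMeasure
    refine eq_isotropicGaussian_of_charFun (Finset.sum_nonneg hv) fun t => ?_
    rw [(h_indep.restrict s).charFun_map_fun_finsetSum_eq_prod fun i hi => (hX i hi).aemeasurable,
      Finset.prod_apply]
    rw [Finset.prod_congr rfl fun i hi => by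
      rw [(hX i hi).map_eq, charFun_isotropicGaussian (hv i hi) t]]
    rw [← Complex.exp_sum, ← Complex.ofReal_sum, Finset.sum_neg_distrib, Finset.sum_mul,
      Finset.sum_div]

lemma indepFun_smul_add_smul_isotropicGaussian {X Y : Ω → E} (ha : 0 ≤ a) (hb : 0 ≤ b)
    (hX : HasLaw X (isotropicGaussian E a) P) (hY : HasLaw Y (isotropicGaussian E b) P)
    (hXY : IndepFun X Y P) {r s r' s' : ℝ} (horth : r * r' * a + s * s' * b = 0) :
    IndepFun (fun ω => r • X ω + s • Y ω) (fun ω => r' • X ω + s' • Y ω) P := by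
  have := hX.hasGaussianLaw.isProbabilityMeasure
  let L (r s : ℝ) : E × E →L[ℝ] E :=
    r • ContinuousLinearMap.fst ℝ E E + s • ContinuousLinearMap.snd ℝ E E
  have hgauss : HasGaussianLaw
      (fun ω => (r • X ω + s • Y ω, r' • X ω + s' • Y ω)) P :=
    (hXY.hasGaussianLaw hX.hasGaussianLaw hY.hasGaussianLaw).map_fun ((L r s).prod (L r' s'))
  refine hgauss.indepFun_of_covariance_inner fun x y => ?_
  have hXm (x : E) : MemLp (fun ω => inner ℝ x (X ω)) 2 P :=
    hX.hasGaussianLaw.memLp_two.const_inner x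
  have hYm (x : E) : MemLp (fun ω => inner ℝ x (Y ω)) 2 P :=
    hY.hasGaussianLaw.memLp_two.const_inner x
  have hcross (x y : E) : cov[fun ω => inner ℝ x (X ω), fun ω => inner ℝ y (Y ω); P] = 0 :=
    (hXY.comp (φ := fun z => inner ℝ x z) (ψ := fun z => inner ℝ y z) (by fun_prop)
      (by fun_prop)).covariance_eq_zero (hXm x) (hYm y)
  simp only [inner_add_right, inner_smul_right]
  change cov[r • (fun ω => inner ℝ x (X ω)) + s • (fun ω => inner ℝ x (Y ω)),
    r' • (fun ω => inner ℝ y (X ω)) + s' • (fun ω => inner ℝ y (Y ω)); P] = 0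
  have hX' := (hXm y).const_smul r'
  have hY' := (hYm y).const_smul s'
  rw [covariance_add_left ((hXm x).const_smul r) ((hYm x).const_smul s) (hX'.add hY'),
    covariance_smul_left, covariance_smul_left, covariance_add_right (hXm x) hX' hY',
    covariance_add_right (hYm x) hX' hY']
  simp only [covariance_smul_right]
  rw [covariance_inner_isotropicGaussian ha hX, covariance_inner_isotropicGaussian hb hY,
    hcross, covariance_comm, hcross]
  linear_combination inner ℝ x y * horth

lemma hasLaw_sub_div_smul_add_isotropicGaussian {X Y : Ω → E} (ha : 0 < a) (hb : 0 ≤ b)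
    (hX : HasLaw X (isotropicGaussian E a) P) (hY : HasLaw Y (isotropicGaussian E b) P)
    (hXY : IndepFun X Y P) :
    HasLaw (fun ω => X ω - (a / (a + b)) • (X ω + Y ω))
      (isotropicGaussian E (a * b / (a + b))) P := by
  have hab : a + b ≠ 0 := by positivity
  have hvar : a * b / (a + b) = (b / (a + b)) ^ 2 * a + (-(a / (a + b))) ^ 2 * b := by
    field_simp
    ring
  simp only [sub_div_smul_add hab, hvar]
  exact hasLaw_add_isotropicGaussian (by positivity) (by positivity)
    (hasLaw_smul_isotropicGaussian ha.le hX _) (hasLaw_smul_isotropicGaussian hb hY _)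
    (hXY.comp (measurable_const_smul _) (measurable_const_smul _))

lemma indepFun_add_sub_div_smul_add_isotropicGaussian {X Y : Ω → E} (ha : 0 < a) (hb : 0 ≤ b)
    (hX : HasLaw X (isotropicGaussian E a) P) (hY : HasLaw Y (isotropicGaussian E b) P)
    (hXY : IndepFun X Y P) :
    IndepFun (fun ω => X ω + Y ω) (fun ω => X ω - (a / (a + b)) • (X ω + Y ω)) P := by
  have hab : a + b ≠ 0 := by positivity
  have horth : 1 * (b / (a + b)) * a + 1 * -(a / (a + b)) * b = 0 := by ring
  simpa only [sub_div_smul_add hab, one_smul] using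
    indepFun_smul_add_smul_isotropicGaussian ha.le hb hX hY hXY horth

lemma hasLaw_norm_div_sqrt_isotropicGaussian {X : Ω → E} (hv : 0 < v)
    (hX : HasLaw X (isotropicGaussian E v) P) :
    HasLaw (fun ω => ‖X ω‖ / Real.sqrt v) (chiDist (Module.finrank ℝ E)) P := by
  have hstd : HasLaw (fun ω => (Real.sqrt v)⁻¹ • X ω) (stdGaussian E) P := by
    have h := hasLaw_smul_isotropicGaussian hv.le hX (Real.sqrt v)⁻¹
    rwa [inv_pow, Real.sq_sqrt hv.le, inv_mul_cancel₀ hv.ne', isotropicGaussian_one] at h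
  refine ((hasLaw_norm_stdGaussian E).fun_comp hstd).congr (.of_forall fun ω => ?_)
  simp only [norm_smul, norm_inv, Real.norm_of_nonneg (Real.sqrt_nonneg v)]
  rw [div_eq_inv_mul]

end IsotropicGaussian

section Complex

variable {Ω : Type*} [MeasurableSpace Ω] {P : Measure Ω}

lemma charFun_gaussianReal_zero_toNNReal {v : ℝ} (hv : 0 ≤ v) (t : ℝ) :
    charFun (gaussianReal 0 v.toNNReal) t = Complex.exp ((-(v * t ^ 2 / 2) : ℝ) : ℂ) := by
  rw [charFun_gaussianReal, Real.coe_toNNReal _ hv]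
  congr 1
  push_cast
  ring

lemma complexGaussian_eq_isotropicGaussian {c : ℝ} (hc : 0 ≤ c) :
    complexGaussian c = isotropicGaussian ℂ (c / 2) := by
  have : IsFiniteMeasure (complexGaussian c) := Measure.isFiniteMeasure_map _ _
  refine eq_isotropicGaussian_of_charFun (by positivity) fun t => ?_
  have hinner (x y : ℝ) : inner ℝ ((x : ℂ) + y * Complex.I) t = x * t.re + y * t.im := by
    simp [Complex.inner, mul_comm]
  have hfactor : charFun (complexGaussian c) t =
      charFun (gaussianReal 0 (c / 2).toNNReal) t.re *
        charFun (gaussianReal 0 (c / 2).toNNReal) t.im := by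
    rw [complexGaussian, charFun_apply, integral_map (by fun_prop) (by fun_prop),
      charFun_apply_real, charFun_apply_real, ← integral_prod_mul]
    congr 1 with p
    rw [hinner, ← Complex.exp_add]
    push_cast
    ring_nf
  rw [hfactor, charFun_gaussianReal_zero_toNNReal (by positivity),
    charFun_gaussianReal_zero_toNNReal (by positivity), ← Complex.exp_add, ← Complex.ofReal_add,
    ← Complex.normSq_eq_norm_sq, Complex.normSq_apply]
  congr 2
  ring

lemma map_toLp_pi_isotropicGaussian {ι F : Type*} [Fintype ι] [NormedAddCommGroup F]
    [InnerProductSpace ℝ F] [FiniteDimensional ℝ F] [MeasurableSpace F] [BorelSpace F] {v : ℝ}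
    (hv : 0 ≤ v) :
    (Measure.pi fun _ : ι => isotropicGaussian F v).map (WithLp.toLp 2) =
      isotropicGaussian (PiLp 2 fun _ : ι => F) v := by
  refine eq_isotropicGaussian_of_charFun hv fun t => ?_
  rw [charFun_pi]
  simp_rw [charFun_isotropicGaussian hv]
  rw [← Complex.exp_sum, ← Complex.ofReal_sum, PiLp.norm_sq_eq_of_L2, Finset.sum_neg_distrib,
    Finset.mul_sum, Finset.sum_div]

lemma complexGaussianVec_eq_isotropicGaussian {M : ℕ} {c : ℝ} (hc : 0 ≤ c) :
    complexGaussianVec M c = isotropicGaussian (EuclideanSpace ℂ (Fin M)) (c / 2) := by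
  rw [complexGaussianVec, complexGaussian_eq_isotropicGaussian hc]
  exact map_toLp_pi_isotropicGaussian (by positivity)

variable {ι : Type*} [Fintype ι] {v c : ℝ}

lemma hasLaw_inner_isotropicGaussian {X : Ω → EuclideanSpace ℂ ι} (hv : 0 ≤ v)
    (hX : HasLaw X (isotropicGaussian _ v) P) (w : EuclideanSpace ℂ ι) :
    HasLaw (fun ω => inner ℂ (X ω) w) (isotropicGaussian ℂ (‖w‖ ^ 2 * v)) P where
  map_eq := by
    have := hX.hasGaussianLaw.isProbabilityMeasure
    refine eq_isotropicGaussian_of_charFun (by positivity) fun t => ?_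
    have hinner (x : EuclideanSpace ℂ ι) :
        inner ℝ (inner ℂ x w) t = inner ℝ x ((starRingEnd ℂ t) • w) := by
      have hre (x y : EuclideanSpace ℂ ι) : inner ℝ x y = (inner ℂ x y).re := by
        simp [PiLp.inner_apply, Complex.inner, mul_comm]
      rw [hre, Complex.inner, inner_smul_right, ← Complex.conj_re]
      simp
    have hchar : charFun (P.map fun ω => inner ℂ (X ω) w) t =
        charFun (P.map X) ((starRingEnd ℂ t) • w) := by
      rw [charFun_apply, charFun_apply, integral_map (by fun_prop) (by fun_prop),
        integral_map (by fun_prop) (by fun_prop)]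
      simp only [hinner]
    rw [hchar, hX.map_eq, charFun_isotropicGaussian hv, norm_smul, RCLike.norm_conj]
    congr 2
    ring

lemma map_inner_add_isotropicGaussian (hv : 0 ≤ v) (hc : 0 ≤ c) (w : EuclideanSpace ℂ ι) :
    ((isotropicGaussian (EuclideanSpace ℂ ι) v).prod (isotropicGaussian ℂ c)).map
      (fun p => inner ℂ p.1 w + p.2) = isotropicGaussian ℂ (‖w‖ ^ 2 * v + c) :=
  (hasLaw_add_isotropicGaussian (by positivity) hc
    (hasLaw_inner_isotropicGaussian hv measurePreserving_fst.hasLaw w)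
    measurePreserving_snd.hasLaw (indepFun_prod (X := fun x => inner ℂ x w) (Y := id)
      (by fun_prop) measurable_id)).map_eq

lemma hasLaw_inner_add_and_indepFun_isotropicGaussian {α : Type*} [MeasurableSpace α]
    {U : Ω → α} {μ : Measure α} {X : Ω → EuclideanSpace ℂ ι} {Z : Ω → ℂ}
    {w : α → EuclideanSpace ℂ ι} {r : ℝ} (hv : 0 ≤ v) (hc : 0 ≤ c) (hU : HasLaw U μ P)
    (hX : HasLaw X (isotropicGaussian _ v) P) (hZ : HasLaw Z (isotropicGaussian ℂ c) P)
    (hUX : IndepFun U X P) (hUXZ : IndepFun (fun ω => (U ω, X ω)) Z P) (hw : Measurable w)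
    (hw_norm : ∀ᵐ u ∂μ, ‖w u‖ ^ 2 = r) :
    HasLaw (fun ω => inner ℂ (X ω) (w (U ω)) + Z ω) (isotropicGaussian ℂ (r * v + c)) P ∧
      IndepFun U (fun ω => inner ℂ (X ω) (w (U ω)) + Z ω) P := by
  have := hX.hasGaussianLaw.isProbabilityMeasure
  have hXZ : IndepFun X Z P := hUXZ.comp measurable_snd measurable_id
  refine hasLaw_and_indepFun_of_ae_map_eq (f := fun u p => inner ℂ p.1 (w u) + p.2) hU
    (hXZ.hasLaw_prod hX hZ) (indepFun_prodMk_right_of_prodMk_left hU.aemeasurable hX.aemeasurable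
      hZ.aemeasurable hUX hUXZ) (by unfold Function.uncurry; fun_prop) ?_
  filter_upwards [hw_norm] with u hu
  rw [map_inner_add_isotropicGaussian hv hc, hu]

end Complex

section Downlink

variable {Ω : Type*} [MeasurableSpace Ω] {P : Measure Ω} {K M : ℕ}

lemma norm_precoder (q : ℝ) {u : EuclideanSpace ℂ (Fin M)} (hu : u ≠ 0) :
    ‖precoder q u‖ = Real.sqrt q := by
  rw [precoder, norm_smul, Complex.norm_real, norm_div, norm_norm,
    div_mul_cancel₀ _ (norm_ne_zero_iff.2 hu), Real.norm_of_nonneg (Real.sqrt_nonneg _)]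

lemma inner_precoder_self (q : ℝ) (u : EuclideanSpace ℂ (Fin M)) :
    inner ℂ u (precoder q u) = ((Real.sqrt q * ‖u‖ : ℝ) : ℂ) := by
  have hnorm : Real.sqrt q / ‖u‖ * ‖u‖ ^ 2 = Real.sqrt q * ‖u‖ := by
    rw [sq, div_mul_eq_mul_div, mul_div_assoc, mul_self_div_self]
  rw [precoder, inner_smul_right, inner_self_eq_norm_sq_to_K, ← hnorm, Complex.ofReal_mul,
    Complex.ofReal_pow]
  rfl

@[fun_prop]
lemma measurable_precoder (q : ℝ) : Measurable (precoder (M := M) q) := by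
  unfold precoder
  fun_prop

/-- The noise at a user with channel `x` and receiver noise `z`, when the base station precodes
along the channel estimate `u`: what remains of the received signal once the part of `x` explained
by `u`, namely `r • u`, is split off. -/
noncomputable def effectiveNoise (q r : ℝ) (x u : EuclideanSpace ℂ (Fin M)) (z : ℂ) : ℂ :=
  inner ℂ (x - r • u) (precoder q u) + z

lemma inner_precoder_add (q r : ℝ) (x u : EuclideanSpace ℂ (Fin M)) (z : ℂ) :
    inner ℂ x (precoder q u) + z =
      ((r * (Real.sqrt q * ‖u‖) : ℝ) : ℂ) + effectiveNoise q r x u z := by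
  rw [effectiveNoise, inner_sub_left, ← Complex.coe_smul, inner_smul_left, inner_precoder_self,
    Complex.conj_ofReal]
  push_cast
  ring

lemma hasLaw_effectiveNoise_and_indepFun (hM : 0 < M) {a b c q : ℝ} (ha : 0 < a) (hb : 0 ≤ b)
    (hc : 0 ≤ c) (hq : 0 ≤ q) {X Y : Ω → EuclideanSpace ℂ (Fin M)} {Z : Ω → ℂ}
    (hX : HasLaw X (complexGaussianVec M a) P) (hY : HasLaw Y (complexGaussianVec M b) P)
    (hZ : HasLaw Z (complexGaussian c) P) (hXY : IndepFun X Y P)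
    (hXYZ : IndepFun (fun ω => (X ω, Y ω)) Z P) :
    HasLaw (fun ω => effectiveNoise q (a / (a + b)) (X ω) (X ω + Y ω) (Z ω))
        (complexGaussian (q * (a * b / (a + b)) + c)) P ∧
      IndepFun (fun ω => X ω + Y ω)
        (fun ω => effectiveNoise q (a / (a + b)) (X ω) (X ω + Y ω) (Z ω)) P := by
  have hvar : (q * (a * b / (a + b)) + c) / 2 =
      q * (a / 2 * (b / 2) / (a / 2 + b / 2)) + c / 2 := by
    field_simp
  have hratio : a / (a + b) = a / 2 / (a / 2 + b / 2) := by
    rw [← add_div, div_div_div_cancel_right₀ two_ne_zero]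
  rw [complexGaussianVec_eq_isotropicGaussian ha.le] at hX
  rw [complexGaussianVec_eq_isotropicGaussian hb] at hY
  rw [complexGaussian_eq_isotropicGaussian hc] at hZ
  rw [complexGaussian_eq_isotropicGaussian (by positivity), hvar, hratio]
  have : Nonempty (Fin M) := ⟨⟨0, hM⟩⟩
  have := nullSingletonClass_isotropicGaussian (E := EuclideanSpace ℂ (Fin M))
    (v := a / 2 + b / 2) (by positivity)
  refine hasLaw_inner_add_and_indepFun_isotropicGaussian (by positivity) (by positivity)
    (hasLaw_add_isotropicGaussian (by positivity) (by positivity) hX hY hXY)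
    (hasLaw_sub_div_smul_add_isotropicGaussian (by positivity) (by positivity) hX hY hXY) hZ
    (indepFun_add_sub_div_smul_add_isotropicGaussian (by positivity) (by positivity) hX hY hXY)
    (hXYZ.comp (φ := fun p => (p.1 + p.2, p.1 - (a / 2 / (a / 2 + b / 2)) • (p.1 + p.2)))
      (by fun_prop) measurable_id) (measurable_precoder q) ?_
  filter_upwards [Measure.ae_ne _ 0] with u hu
  rw [norm_precoder q hu, Real.sq_sqrt hq]

lemma hasLaw_norm_complexGaussianVec {v : ℝ} (hv : 0 < v) {X : Ω → EuclideanSpace ℂ (Fin M)}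
    (hX : HasLaw X (complexGaussianVec M v) P) :
    HasLaw (fun ω => Real.sqrt (2 / v) * ‖X ω‖) (chiDist (2 * M)) P := by
  rw [complexGaussianVec_eq_isotropicGaussian hv.le] at hX
  have hdim : Module.finrank ℝ (EuclideanSpace ℂ (Fin M)) = 2 * M := by
    rw [finrank_real_of_complex, finrank_euclideanSpace_fin]
  rw [← hdim]
  refine (hasLaw_norm_div_sqrt_isotropicGaussian (half_pos hv) hX).congr (.of_forall fun ω => ?_)
  change Real.sqrt (2 / v) * ‖X ω‖ = ‖X ω‖ / Real.sqrt (v / 2)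
  rw [← inv_div v 2, Real.sqrt_inv, ← div_eq_inv_mul]

/-- The variance `α_S + σ² / ρ` of the coordinates of the least-squares estimate when the users in
`S` share the pilot. -/
noncomputable def estimateVariance (S : Finset (Fin K)) (ρ σ : ℝ) (β : Fin K → ℝ) : ℝ :=
  sumGain S β + σ ^ 2 / ρ

lemma estimateVariance_nonneg {S : Finset (Fin K)} {ρ : ℝ} (hρ : 0 < ρ) (σ : ℝ) {β : Fin K → ℝ}
    (hβ : ∀ i ∈ S, 0 ≤ β i) : 0 ≤ estimateVariance S ρ σ β :=
  add_nonneg (Finset.sum_nonneg hβ) (by positivity)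

lemma le_estimateVariance {S : Finset (Fin K)} {k : Fin K} (hk : k ∈ S) {ρ : ℝ} (hρ : 0 < ρ) (σ : ℝ)
    {β : Fin K → ℝ} (hβ : ∀ i ∈ S, 0 ≤ β i) : β k ≤ estimateVariance S ρ σ β :=
  (Finset.single_le_sum hβ hk).trans (le_add_of_nonneg_right (by positivity))

lemma lsEstimate_uplinkSignal (S : Finset (Fin K)) {ρ : ℝ} (hρ : 0 < ρ)
    (h : Fin K → EuclideanSpace ℂ (Fin M)) (n : EuclideanSpace ℂ (Fin M)) :
    lsEstimate ρ (uplinkSignal S ρ h n) = ∑ i ∈ S, h i + (1 / Real.sqrt ρ) • n := by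
  have hs : ((1 / Real.sqrt ρ : ℝ) : ℂ) * ((Real.sqrt ρ : ℝ) : ℂ) = 1 := by
    rw [← Complex.ofReal_mul, one_div_mul_cancel (Real.sqrt_pos.2 hρ).ne', Complex.ofReal_one]
  rw [lsEstimate, uplinkSignal, ← Finset.smul_sum, smul_add, smul_smul, hs, one_smul,
    Complex.coe_smul]

lemma lsEstimate_uplinkSignal_eq_add_erase {S : Finset (Fin K)} {k : Fin K} (hk : k ∈ S) {ρ : ℝ}
    (hρ : 0 < ρ) (h : Fin K → EuclideanSpace ℂ (Fin M)) (n : EuclideanSpace ℂ (Fin M)) :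
    lsEstimate ρ (uplinkSignal S ρ h n) =
      h k + lsEstimate ρ (uplinkSignal (S.erase k) ρ h n) := by
  rw [lsEstimate_uplinkSignal S hρ, lsEstimate_uplinkSignal _ hρ, ← Finset.add_sum_erase S h hk,
    add_assoc]

lemma estimateVariance_eq_add_erase {S : Finset (Fin K)} {k : Fin K} (hk : k ∈ S) (ρ σ : ℝ)
    (β : Fin K → ℝ) :
    estimateVariance S ρ σ β = β k + estimateVariance (S.erase k) ρ σ β := by
  rw [estimateVariance, estimateVariance, sumGain, sumGain, ← Finset.add_sum_erase S β hk,
    add_assoc]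

lemma mul_div_mul_sumGain_add {S : Finset (Fin K)} {ρ : ℝ} (hρ : ρ ≠ 0) (σ a : ℝ) (β : Fin K → ℝ) :
    ρ * a / (ρ * sumGain S β + σ ^ 2) = a / estimateVariance S ρ σ β := by
  rw [← mul_div_mul_left a _ hρ, estimateVariance, mul_add, mul_div_cancel₀ _ hρ]

lemma sqrt_half_mul_sqrt_two_div {a v : ℝ} (ha : 0 ≤ a) (hv : 0 < v) (q : ℝ) :
    Real.sqrt (1 / 2 * (q * a ^ 2 / v)) * Real.sqrt (2 / v) = a / v * Real.sqrt q := by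
  have hprod : 1 / 2 * (q * a ^ 2 / v) * (2 / v) = (a / v) ^ 2 * q := by field_simp
  rw [← Real.sqrt_mul' _ (by positivity), hprod, Real.sqrt_mul (sq_nonneg _),
    Real.sqrt_sq (by positivity)]

lemma add_mul_sub_div_add {a b : ℝ} (hab : a + b ≠ 0) (c q : ℝ) :
    c + q * a - q * a ^ 2 / (a + b) = q * (a * b / (a + b)) + c := by
  field_simp
  ring

lemma add_mul_sub_div_nonneg {a c q v : ℝ} (ha : 0 ≤ a) (hav : a ≤ v) (hc : 0 ≤ c) (hq : 0 ≤ q) :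
    0 ≤ c + q * a - q * a ^ 2 / v := by
  have hle : q * a ^ 2 / v ≤ q * a :=
    div_le_of_le_mul₀ (ha.trans hav) (by positivity) (by rw [sq, ← mul_assoc]; gcongr)
  linarith

section Uplink

variable {h : Fin K → Ω → EuclideanSpace ℂ (Fin M)} {n : Ω → EuclideanSpace ℂ (Fin M)}
  {β : Fin K → ℝ} {S : Finset (Fin K)} {ρ σ : ℝ}

lemma hasLaw_lsEstimate_uplinkSignal (hρ : 0 < ρ) (hβ : ∀ i ∈ S, 0 ≤ β i)
    (hh : ∀ i ∈ S, HasLaw (h i) (complexGaussianVec M (β i)) P)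
    (hn : HasLaw n (complexGaussianVec M (σ ^ 2)) P) (h_indep : iIndepFun h P)
    (hn_indep : IndepFun (fun ω i => h i ω) n P) :
    HasLaw (fun ω => lsEstimate ρ (uplinkSignal S ρ (fun i => h i ω) (n ω)))
      (complexGaussianVec M (estimateVariance S ρ σ β)) P := by
  have hvar : estimateVariance S ρ σ β / 2 =
      ∑ i ∈ S, β i / 2 + (1 / Real.sqrt ρ) ^ 2 * (σ ^ 2 / 2) := by
    rw [estimateVariance, sumGain, ← Finset.sum_div, div_pow, Real.sq_sqrt hρ.le]
    ring
  have hsum_indep : IndepFun (fun ω => ∑ i ∈ S, h i ω) (fun ω => (1 / Real.sqrt ρ) • n ω) P :=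
    hn_indep.comp (φ := fun v : Fin K → EuclideanSpace ℂ (Fin M) => ∑ i ∈ S, v i)
      (ψ := fun v => (1 / Real.sqrt ρ) • v) (by fun_prop) (by fun_prop)
  have hβ2 : ∀ i ∈ S, 0 ≤ β i / 2 := fun i hi => div_nonneg (hβ i hi) zero_le_two
  rw [complexGaussianVec_eq_isotropicGaussian (sq_nonneg σ)] at hn
  rw [complexGaussianVec_eq_isotropicGaussian (estimateVariance_nonneg hρ σ hβ), hvar]
  simp only [lsEstimate_uplinkSignal S hρ]
  exact hasLaw_add_isotropicGaussian (Finset.sum_nonneg hβ2) (by positivity)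
    (hasLaw_sum_isotropicGaussian hβ2
      (fun i hi => complexGaussianVec_eq_isotropicGaussian (hβ i hi) ▸ hh i hi) h_indep)
    (hasLaw_smul_isotropicGaussian (by positivity) hn _) hsum_indep

lemma indepFun_lsEstimate_uplinkSignal {k : Fin K} (hk : k ∉ S) (hρ : 0 < ρ)
    (hh : ∀ i, AEMeasurable (h i) P) (hn : AEMeasurable n P) (h_indep : iIndepFun h P)
    (hn_indep : IndepFun (fun ω i => h i ω) n P) :
    IndepFun (h k) (fun ω => lsEstimate ρ (uplinkSignal S ρ (fun i => h i ω) (n ω))) P := by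
  have := h_indep.isProbabilityMeasure
  have hsum_indep : IndepFun (h k) (fun ω => ∑ i ∈ S, h i ω) P := by
    convert (h_indep.indepFun_finsetSum_of_notMem₀ hh hk).symm using 1
    simp only [← Finset.sum_fn]
  have hpair_indep : IndepFun (fun ω => (h k ω, ∑ i ∈ S, h i ω)) n P :=
    hn_indep.comp (φ := fun v => (v k, ∑ i ∈ S, v i)) (by fun_prop) measurable_id
  simp only [lsEstimate_uplinkSignal S hρ]
  exact (indepFun_prodMk_right_of_prodMk_left (hh k) (by fun_prop) hn hsum_indep hpair_indep).comp
    (ψ := fun p => p.1 + (1 / Real.sqrt ρ) • p.2) measurable_id (by fun_prop)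

lemma hasLaw_effectiveNoise_lsEstimate_and_indepFun (hM : 0 < M) {q c : ℝ} {k : Fin K} (hk : k ∈ S)
    (hρ : 0 < ρ) (hq : 0 ≤ q) (hc : 0 ≤ c) (hβk : 0 < β k) (hβ : ∀ i ∈ S, 0 ≤ β i)
    (hh : ∀ i, HasLaw (h i) (complexGaussianVec M (β i)) P)
    (hn : HasLaw n (complexGaussianVec M (σ ^ 2)) P) (h_indep : iIndepFun h P)
    (hn_indep : IndepFun (fun ω i => h i ω) n P) {Z : Ω → ℂ} (hZ : HasLaw Z (complexGaussian c) P)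
    (hZ_indep : IndepFun (fun ω => ((fun i => h i ω), n ω)) Z P) :
    let U ω := lsEstimate ρ (uplinkSignal S ρ (fun i => h i ω) (n ω))
    let γ := estimateVariance S ρ σ β
    let ν ω := effectiveNoise q (β k / γ) (h k ω) (U ω) (Z ω)
    HasLaw ν (complexGaussian (c + q * β k - q * β k ^ 2 / γ)) P ∧ IndepFun U ν P := by
  have hβ' : ∀ i ∈ S.erase k, 0 ≤ β i := fun i hi => hβ i (Finset.mem_of_mem_erase hi)
  have hτ : 0 ≤ estimateVariance (S.erase k) ρ σ β := estimateVariance_nonneg hρ σ hβ'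
  have hY := hasLaw_lsEstimate_uplinkSignal hρ hβ' (fun i _ => hh i) hn h_indep hn_indep
  have hXY := indepFun_lsEstimate_uplinkSignal (S.notMem_erase k) hρ
    (fun i => (hh i).aemeasurable) hn.aemeasurable h_indep hn_indep
  have hXYZ := hZ_indep.comp
    (φ := fun p => (p.1 k, lsEstimate ρ (uplinkSignal (S.erase k) ρ p.1 p.2)))
    (by simp only [lsEstimate_uplinkSignal _ hρ]; fun_prop) measurable_id
  simp only [lsEstimate_uplinkSignal_eq_add_erase hk hρ, estimateVariance_eq_add_erase hk]
  rw [add_mul_sub_div_add (by positivity)]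
  exact hasLaw_effectiveNoise_and_indepFun hM hβk hτ hc hq (hh k) hY hZ hXY hXYZ

end Uplink

end Downlink

theorem lemma1 {Ω : Type*} [MeasurableSpace Ω] (P : Measure Ω) [IsProbabilityMeasure P]
    (K M : ℕ) (hM : 0 < M) (S : Finset (Fin K))
    (ρ q σ : ℝ) (hρ : 0 < ρ) (hq : 0 ≤ q) (β : Fin K → ℝ) (hβ : ∀ i, 0 < β i)
    (h : Fin K → Ω → EuclideanSpace ℂ (Fin M)) (n : Ω → EuclideanSpace ℂ (Fin M))
    (η : Fin K → Ω → ℂ)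
    (hh : ∀ i, HasLaw (h i) (complexGaussianVec M (β i)) P)
    (hn : HasLaw n (complexGaussianVec M (σ ^ 2)) P)
    (hη : ∀ k ∈ S, HasLaw (η k) (complexGaussian (σ ^ 2)) P)
    -- for each `k` in `S`, the variables `h_1, …, h_K, n, η_k` are mutually independent
    (h_indep : iIndepFun h P)
    (hn_indep : IndepFun (fun ω i => h i ω) n P)
    (hη_indep : ∀ k ∈ S, IndepFun (fun ω => ((fun i => h i ω), n ω)) (η k) P) :
    ∀ k ∈ S, ∃ (g x : Ω → ℝ) (ν : Ω → ℂ),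
      (∀ ω, downlinkSignal S ρ q (fun i => h i ω) (n ω) (fun i => η i ω) k = (g ω : ℂ) + ν ω) ∧
      (∀ ω, g ω =
        Real.sqrt (1 / 2 * (ρ * q * β k ^ 2 / (ρ * sumGain S β + σ ^ 2))) * x ω) ∧
      HasLaw x (chiDist (2 * M)) P ∧
      0 ≤ σ ^ 2 + q * β k - ρ * q * β k ^ 2 / (ρ * sumGain S β + σ ^ 2) ∧
      HasLaw ν
        (complexGaussian (σ ^ 2 + q * β k - ρ * q * β k ^ 2 / (ρ * sumGain S β + σ ^ 2))) P ∧
      IndepFun g ν P := by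
  intro k hk
  have hβ0 : ∀ i ∈ S, 0 ≤ β i := fun i _ => (hβ i).le
  let U ω := lsEstimate ρ (uplinkSignal S ρ (fun i => h i ω) (n ω))
  let γ := estimateVariance S ρ σ β
  have hβγ : β k ≤ γ := le_estimateVariance hk hρ σ hβ0
  have hγ : 0 < γ := (hβ k).trans_le hβγ
  have hU : HasLaw U (complexGaussianVec M γ) P :=
    hasLaw_lsEstimate_uplinkSignal hρ hβ0 (fun i _ => hh i) hn h_indep hn_indep
  obtain ⟨hν, hUν⟩ := hasLaw_effectiveNoise_lsEstimate_and_indepFun hM hk hρ hq (sq_nonneg σ)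
    (hβ k) hβ0 hh hn h_indep hn_indep (hη k hk) (hη_indep k hk)
  rw [mul_assoc ρ q, mul_div_mul_sumGain_add hρ.ne']
  refine ⟨fun ω => β k / γ * (Real.sqrt q * ‖U ω‖), fun ω => Real.sqrt (2 / γ) * ‖U ω‖,
    fun ω => effectiveNoise q (β k / γ) (h k ω) (U ω) (η k ω),
    fun ω => inner_precoder_add q _ _ _ _, fun ω => ?_, hasLaw_norm_complexGaussianVec hγ hU,
    add_mul_sub_div_nonneg (hβ k).le hβγ (sq_nonneg σ) hq, hν,
    hUν.comp (φ := fun u => β k / γ * (Real.sqrt q * ‖u‖)) (by fun_prop) measurable_id⟩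
  rw [← mul_assoc (Real.sqrt _), sqrt_half_mul_sqrt_two_div (hβ k).le hγ, mul_assoc]
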